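/- Let $E$ be a (real) Banach lattice. For $x,y\in E$ write $y\sqsubseteq x$ ("$y$ is a fragment of $x$") if $|y|\wedge|x-y|=0$. A sequence $(x_n)$ in $E$ is called laterally Cauchy if $x_n\sqsubseteq x_m$ for all $n<m$, and laterally norm convergent to $x\in E$ if $x_n\sqsubseteq x_m\sqsubseteq x$ for all $n<m$ and $\|x_n-x\|\to 0$. Recall that $E$ is a KB-space if every increasing norm bounded sequence of positive elements of $E$ is norm convergent. Then $E$ is a KB-space if and only if every norm bounded, laterally Cauchy sequence in $E$ is laterally norm convergent to some element of $E$. -/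

import Mathlib

open Filter Topology

namespace LateralConvergence

/-- Two elements of a vector lattice are disjoint, `x ⊥ y`, if `|x| ⊓ |y| = 0`. -/
def LatticeDisjoint {E : Type*} [Lattice E] [AddCommGroup E] (x y : E) : Prop :=
  |x| ⊓ |y| = 0

/-- `y` is a fragment (component) of `x`, written `y ⊑ x`, if `y ⊥ x - y`. -/
def IsFragment {E : Type*} [Lattice E] [AddCommGroup E] (y x : E) : Prop :=
  LatticeDisjoint y (x - y)

/-- A net is laterally Cauchy if it increases in the fragment order: `x α ⊑ x β` for all
indices `α < β`. -/
def IsLaterallyCauchy {ι E : Type*} [Preorder ι] [Lattice E] [AddCommGroup E]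
    (x : ι → E) : Prop :=
  ∀ α β : ι, α < β → IsFragment (x α) (x β)

/-- A net `x` is laterally norm convergent to `a` if `x α ⊑ x β ⊑ a` for all indices `α < β`
and `x` converges to `a` in norm. -/
def LaterallyNormConvergesTo {ι E : Type*} [Preorder ι] [NormedAddCommGroup E] [Lattice E]
    (x : ι → E) (a : E) : Prop :=
  (∀ α β : ι, α < β → IsFragment (x α) (x β) ∧ IsFragment (x β) a) ∧ Tendsto x atTop (𝓝 a)

/-- A KB-space: every increasing norm bounded sequence of positive elements is norm
convergent. (Applied below to Banach lattices.) -/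
def IsKBSpace (E : Type*) [NormedAddCommGroup E] [Lattice E] : Prop :=
  ∀ x : ℕ → E, (∀ n, 0 ≤ x n) → Monotone x → (∃ C : ℝ, ∀ n, ‖x n‖ ≤ C) →
    ∃ a : E, Tendsto x atTop (𝓝 a)

end LateralConvergence

/-!
The lateral condition and the KB property are linked through sequences of disjoint positive
elements: the partial sums of such a sequence are laterally Cauchy.

In a KB-space, a laterally Cauchy sequence has increasing positive and negative parts
(`IsFragment.posPart_le`, `IsFragment.negPart_le`), which are norm bounded along with the sequence
and hence converge; fragments pass to the limit because the lattice operations are continuous.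

Conversely, the lateral condition makes every disjoint positive sequence with norm bounded partial
sums norm null (`DisjointBoundedSumsNull`), and a space with this property is shown to be KB. It is
enough that every positive sequence `u` with norm bounded partial sums, such as the increments of
an increasing norm bounded sequence, is norm null. This holds when `u` is asymptotically disjoint,
i.e. when `uₙ ⊓ uᵢ → 0` as `n → ∞` for each `i`: a sparse subsequence is then, up to null sequences,
disjoint (`DisjointBoundedSumsNull.tendsto_zero_of_asymptotically_disjoint`). Asymptotic
disjointness is obtained in two rounds.

* If the partial sums of `u` are bounded in order by `x`, then the `(uₙ - x / (k + 1))⁺` overlap at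
  most `k` at a time, and sequences of bounded overlap are asymptotically disjoint by induction on
  the overlap. So `u` is norm null, and increasing order bounded sequences converge
  (`DisjointBoundedSumsNull.exists_tendsto_of_monotone_of_le`).
* If the partial sums of `u` are only norm bounded, this convergence makes the truncated tails
  `(∑_{i≥m} uᵢ) ⊓ y` meaningful for each `y ≥ 0`. They decrease to an element that lies, up to
  small errors, below infinitely many non-overlapping blocks of the series, hence to zero, and they
  dominate `uₘ ⊓ y` (`DisjointBoundedSumsNull.tendsto_inf_zero`). With `y = uᵢ` this is the
  asymptotic disjointness of `u`.
-/

namespace LateralConvergence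

/-! ### Disjointness and fragments in vector lattices -/

theorem IsFragment.neg {E : Type*} [AddCommGroup E] [Lattice E] {y x : E}
    (h : IsFragment y x) : IsFragment (-y) (-x) := by
  have : -x - -y = -(x - y) := by abel
  rw [IsFragment, LatticeDisjoint, this, abs_neg, abs_neg]
  exact h

section Order

variable {E : Type*} [AddCommGroup E] [Lattice E] [IsOrderedAddMonoid E]

theorem inf_add_le_inf_add_inf {a b c : E} (ha : 0 ≤ a) (hb : 0 ≤ b) (hc : 0 ≤ c) :
    a ⊓ (b + c) ≤ a ⊓ b + a ⊓ c := by
  rw [inf_add, add_inf, add_inf]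
  refine le_inf (le_inf ?_ ?_) (le_inf ?_ ?_)
  · exact inf_le_left.trans (le_add_of_nonneg_left ha)
  · exact inf_le_left.trans (le_add_of_nonneg_right hc)
  · exact inf_le_left.trans (le_add_of_nonneg_left hb)
  · exact inf_le_right

theorem inf_sum_le_sum_inf {ι : Type*} (s : Finset ι) {a : E} {u : ι → E} (ha : 0 ≤ a)
    (hu : ∀ i, 0 ≤ u i) : a ⊓ ∑ i ∈ s, u i ≤ ∑ i ∈ s, a ⊓ u i := by
  classical
  induction s using Finset.induction_on with
  | empty => simp
  | insert i s hi ih =>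
    rw [Finset.sum_insert hi, Finset.sum_insert hi]
    exact (inf_add_le_inf_add_inf ha (hu i) (Finset.sum_nonneg fun j _ => hu j)).trans
      (by gcongr)

theorem inf_nsmul_le_nsmul_inf {a b : E} (ha : 0 ≤ a) (hb : 0 ≤ b) (n : ℕ) :
    a ⊓ n • b ≤ n • (a ⊓ b) := by
  simpa using inf_sum_le_sum_inf (Finset.range n) ha (fun _ => hb)

theorem inf_sum_eq_zero {ι : Type*} (s : Finset ι) {a : E} {u : ι → E} (ha : 0 ≤ a)
    (hu : ∀ i, 0 ≤ u i) (h : ∀ i ∈ s, a ⊓ u i = 0) : a ⊓ ∑ i ∈ s, u i = 0 :=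
  le_antisymm ((inf_sum_le_sum_inf s ha hu).trans (Finset.sum_eq_zero h).le)
    (le_inf ha (Finset.sum_nonneg fun i _ => hu i))

/-- From `y ≤ x⁺ + (x - y)⁻`, where the last term is disjoint from `y⁺`. -/
theorem IsFragment.posPart_le {y x : E} (h : IsFragment y x) : y⁺ ≤ x⁺ := by
  have hd : y⁺ ⊓ (x - y)⁻ = 0 := by
    refine le_antisymm ?_ (le_inf (posPart_nonneg _) (negPart_nonneg _))
    rw [← show |y| ⊓ |x - y| = 0 from h]
    gcongr
    · exact sup_le (le_abs_self _) (abs_nonneg _)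
    · exact sup_le (neg_le_abs _) (abs_nonneg _)
  have hy : y⁺ ≤ x⁺ + (x - y)⁻ := by
    refine sup_le ?_ (add_nonneg (posPart_nonneg _) (negPart_nonneg _))
    calc y = x + -(x - y) := by abel
      _ ≤ x⁺ + (x - y)⁻ := add_le_add (le_posPart _) (neg_le_negPart _)
  calc y⁺ = y⁺ ⊓ (x⁺ + (x - y)⁻) := (inf_eq_left.2 hy).symm
    _ ≤ y⁺ ⊓ x⁺ + y⁺ ⊓ (x - y)⁻ :=
      inf_add_le_inf_add_inf (posPart_nonneg _) (posPart_nonneg _) (negPart_nonneg _)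
    _ ≤ x⁺ := by rw [hd, add_zero]; exact inf_le_right

theorem IsFragment.negPart_le {y x : E} (h : IsFragment y x) : y⁻ ≤ x⁻ := by
  simpa using h.neg.posPart_le

theorem sum_comp_le_sum {u : ℕ → E} (hu : ∀ n, 0 ≤ u n) {φ : ℕ → ℕ} (hφ : StrictMono φ) (n : ℕ) :
    ∑ i ∈ Finset.range n, u (φ i) ≤ ∑ i ∈ Finset.range (φ n), u i := by
  rw [← Finset.sum_image (f := u) (g := φ) hφ.injective.injOn]
  refine Finset.sum_le_sum_of_subset_of_nonneg (fun k hk => ?_) fun i _ _ => hu i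
  obtain ⟨i, hi, rfl⟩ := Finset.mem_image.1 hk
  exact Finset.mem_range.2 (hφ (Finset.mem_range.1 hi))

/-- If the sum of finitely many elements is nonpositive, then so is every common lower bound of
their positive parts: if `w` is one, then `w⁺ ≤ ∑ aᵢ⁺ ≤ ∑ aᵢ⁻`, while `w⁺ ≤ aᵢ⁺` is disjoint from
`aᵢ⁻` for each `i`. -/
theorem le_zero_of_forall_le_posPart {ι : Type*} {s : Finset ι} (hs : s.Nonempty) {a : ι → E}
    (ha : ∑ i ∈ s, a i ≤ 0) {w : E} (hw : ∀ i ∈ s, w ≤ (a i)⁺) : w ≤ 0 := by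
  have hw' : ∀ i ∈ s, w⁺ ≤ (a i)⁺ := fun i hi => sup_le (hw i hi) (posPart_nonneg _)
  have hdis : w⁺ ⊓ ∑ i ∈ s, (a i)⁻ = 0 := by
    refine inf_sum_eq_zero s (posPart_nonneg _) (fun _ => negPart_nonneg _) fun i hi => ?_
    refine le_antisymm ?_ (le_inf (posPart_nonneg _) (negPart_nonneg _))
    rw [← posPart_inf_negPart_eq_zero (a i)]
    exact inf_le_inf_right _ (hw' i hi)
  have hle : w⁺ ≤ ∑ i ∈ s, (a i)⁻ := by
    obtain ⟨j, hj⟩ := hs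
    calc w⁺ ≤ (a j)⁺ := hw' j hj
      _ ≤ ∑ i ∈ s, (a i)⁺ :=
        Finset.single_le_sum (f := fun i => (a i)⁺) (fun i _ => posPart_nonneg _) hj
      _ = ∑ i ∈ s, a i + ∑ i ∈ s, (a i)⁻ := by
        rw [← Finset.sum_add_distrib]
        refine Finset.sum_congr rfl fun i _ => ?_
        exact (sub_eq_iff_eq_add.1 (posPart_sub_negPart (a i)))
      _ ≤ ∑ i ∈ s, (a i)⁻ := add_le_of_nonpos_left ha
  rw [inf_eq_left.2 hle] at hdis
  exact posPart_eq_zero.1 hdis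

/-- The truncations `(uₙ - 4ⁿ ∑_{i<n} uᵢ - 2⁻ⁿ x)⁺`, where `2⁻ᵐ uₘ ≤ x` for all `m`, are
pairwise disjoint: for `n < m` the two of them are dominated by `(4ᵐ uₙ - uₘ)⁺` and
`(4ᵐ uₙ - uₘ)⁻` respectively. -/
theorem inf_posPart_truncation_eq_zero [Module ℝ E] [IsOrderedModule ℝ E]
    {u : ℕ → E} {x : E} (hu : ∀ n, 0 ≤ u n)
    (hx : ∀ n, (1 / 2 : ℝ) ^ n • u n ≤ x) {n m : ℕ} (hnm : n < m) :
    (u n - (4 ^ n : ℕ) • ∑ i ∈ Finset.range n, u i - (1 / 2 : ℝ) ^ n • x)⁺ ⊓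
      (u m - (4 ^ m : ℕ) • ∑ i ∈ Finset.range m, u i - (1 / 2 : ℝ) ^ m • x)⁺ = 0 := by
  have hx0 : 0 ≤ x := (smul_nonneg (by positivity) (hu 0)).trans (hx 0)
  have hS : ∀ k, 0 ≤ ∑ i ∈ Finset.range k, u i := fun k => Finset.sum_nonneg fun i _ => hu i
  set d : E := (4 ^ m : ℕ) • u n - u m with hd
  refine le_antisymm ?_ (le_inf (posPart_nonneg _) (posPart_nonneg _))
  rw [← posPart_inf_negPart_eq_zero d]
  refine le_inf (inf_le_left.trans ?_) (inf_le_right.trans ?_)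
  · refine sup_le ?_ (posPart_nonneg _)
    have h1 : u n - (4 ^ n : ℕ) • ∑ i ∈ Finset.range n, u i - (1 / 2 : ℝ) ^ n • x ≤
        (1 / 4 : ℝ) ^ m • d := by
      have h2 : (1 / 4 : ℝ) ^ m • u m ≤ (1 / 2 : ℝ) ^ n • x := by
        calc (1 / 4 : ℝ) ^ m • u m = (1 / 2 : ℝ) ^ m • ((1 / 2 : ℝ) ^ m • u m) := by
              rw [smul_smul, ← mul_pow]; norm_num
          _ ≤ (1 / 2 : ℝ) ^ m • x := smul_le_smul_of_nonneg_left (hx m) (by positivity)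
          _ ≤ (1 / 2 : ℝ) ^ n • x := smul_le_smul_of_nonneg_right
              (pow_le_pow_of_le_one (by norm_num) (by norm_num) hnm.le) hx0
      have h3 : (1 / 4 : ℝ) ^ m • d = u n - (1 / 4 : ℝ) ^ m • u m := by
        rw [hd, smul_sub, ← Nat.cast_smul_eq_nsmul ℝ, smul_smul]
        push_cast
        rw [← mul_pow]
        norm_num
      rw [h3]
      exact sub_le_sub (sub_le_self _ (nsmul_nonneg (hS n) _)) h2
    refine h1.trans ?_
    calc (1 / 4 : ℝ) ^ m • d ≤ (1 / 4 : ℝ) ^ m • d⁺ :=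
          smul_le_smul_of_nonneg_left (le_posPart d) (by positivity)
      _ ≤ (1 : ℝ) • d⁺ := smul_le_smul_of_nonneg_right
          (pow_le_one₀ (by norm_num) (by norm_num)) (posPart_nonneg d)
      _ = d⁺ := one_smul _ _
  · refine sup_le ?_ (negPart_nonneg _)
    refine le_trans ?_ (neg_le_negPart d)
    rw [hd, neg_sub]
    refine (sub_le_self _ (smul_nonneg (by positivity) hx0)).trans ?_
    refine sub_le_sub_left (nsmul_le_nsmul_right ?_ _) _
    exact Finset.single_le_sum (f := u) (fun i _ => hu i) (Finset.mem_range.2 hnm)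

end Order

/-! ### Monotone and laterally Cauchy sequences in norm -/

theorem cauchySeq_of_forall_strictMono {E : Type*} [SeminormedAddCommGroup E] {x : ℕ → E}
    (h : ∀ φ : ℕ → ℕ, StrictMono φ →
      Tendsto (fun n => x (φ (n + 1)) - x (φ n)) atTop (𝓝 0)) : CauchySeq x := by
  rw [Metric.cauchySeq_iff']
  by_contra! hc
  obtain ⟨ε, hε, hc⟩ := hc
  choose f hf hfε using hc
  have hlt : ∀ n, n < f n := fun n => by
    refine lt_of_le_of_ne (hf n) fun he => ?_
    have := hfε n
    rw [← he, dist_self] at this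
    exact absurd hε this.not_gt
  have hφ : StrictMono fun n => f^[n] 0 := strictMono_nat_of_lt_succ fun n => by
    rw [Function.iterate_succ_apply']; exact hlt _
  have h0 := (tendsto_zero_iff_norm_tendsto_zero.1 (h _ hφ)).eventually_lt_const hε
  obtain ⟨n, hn⟩ := h0.exists
  rw [Function.iterate_succ_apply', ← dist_eq_norm] at hn
  exact absurd (hfε _) hn.not_ge

section Norm

variable {E : Type*} [NormedAddCommGroup E] [Lattice E] [IsOrderedAddMonoid E]

/-- Every disjoint sequence of positive elements with norm bounded partial sums is norm null.
Among Banach lattices, this says that `c₀` does not embed as a sublattice. -/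
def DisjointBoundedSumsNull (E : Type*) [NormedAddCommGroup E] [Lattice E] : Prop :=
  ∀ v : ℕ → E, (∀ n, 0 ≤ v n) → (∀ i j, i < j → v i ⊓ v j = 0) →
    (∃ C : ℝ, ∀ n, ‖∑ i ∈ Finset.range n, v i‖ ≤ C) → Tendsto v atTop (𝓝 0)

theorem disjointBoundedSumsNull_of_lateral
    (h : ∀ x : ℕ → E, (∃ C : ℝ, ∀ n, ‖x n‖ ≤ C) → IsLaterallyCauchy x →
      ∃ a : E, LaterallyNormConvergesTo x a) : DisjointBoundedSumsNull E := by
  intro v hv hd hb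
  obtain ⟨a, -, ha⟩ := h (fun n => ∑ i ∈ Finset.range n, v i) hb fun n m hnm => by
    have hdiff : ∑ i ∈ Finset.range m, v i - ∑ i ∈ Finset.range n, v i =
        ∑ i ∈ Finset.Ico n m, v i := (Finset.sum_Ico_eq_sub _ hnm.le).symm
    have h1 : 0 ≤ ∑ i ∈ Finset.range n, v i := Finset.sum_nonneg fun i _ => hv i
    have h2 : 0 ≤ ∑ i ∈ Finset.Ico n m, v i := Finset.sum_nonneg fun i _ => hv i
    -- The fragment condition: the first `n` terms are disjoint from the terms in `[n, m)`.
    rw [IsFragment, LatticeDisjoint, hdiff, abs_of_nonneg h1, abs_of_nonneg h2]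
    refine inf_sum_eq_zero _ h1 hv fun j hj => ?_
    rw [inf_comm]
    refine inf_sum_eq_zero _ (hv j) hv fun i hi => ?_
    rw [inf_comm]
    exact hd i j ((Finset.mem_range.1 hi).trans_le (Finset.mem_Ico.1 hj).1)
  have := ((tendsto_add_atTop_iff_nat 1).2 ha).sub ha
  simpa [Finset.sum_range_succ] using this

variable [HasSolidNorm E]

theorem norm_le_norm_of_nonneg_of_le {a b : E} (ha : 0 ≤ a) (hab : a ≤ b) : ‖a‖ ≤ ‖b‖ :=
  norm_le_norm_of_abs_le_abs (by rwa [abs_of_nonneg ha, abs_of_nonneg (ha.trans hab)])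

theorem tendsto_zero_of_nonneg_of_le {u v : ℕ → E} (hu : ∀ n, 0 ≤ u n) (huv : ∀ n, u n ≤ v n)
    (hv : Tendsto v atTop (𝓝 0)) : Tendsto u atTop (𝓝 0) :=
  squeeze_zero_norm (fun n => norm_le_norm_of_nonneg_of_le (hu n) (huv n))
    (tendsto_zero_iff_norm_tendsto_zero.1 hv)

theorem IsFragment.of_tendsto {x : ℕ → E} (hx : IsLaterallyCauchy x) {a : E}
    (ha : Tendsto x atTop (𝓝 a)) (n : ℕ) : IsFragment (x n) a := by
  have h1 : Tendsto (fun m => |x n| ⊓ |x m - x n|) atTop (𝓝 (|x n| ⊓ |a - x n|)) := by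
    have h2 : Continuous fun z : E => |x n| ⊓ |z - x n| := by
      simp only [abs]
      fun_prop
    exact (h2.tendsto a).comp ha
  refine tendsto_nhds_unique h1 (tendsto_const_nhds.congr' ?_)
  filter_upwards [eventually_gt_atTop n] with m hm
  exact (hx n m hm).symm

theorem IsKBSpace.exists_laterallyNormConvergesTo (hE : IsKBSpace E) {x : ℕ → E}
    (hb : ∃ C : ℝ, ∀ n, ‖x n‖ ≤ C) (hx : IsLaterallyCauchy x) :
    ∃ a : E, LaterallyNormConvergesTo x a := by
  obtain ⟨C, hC⟩ := hb
  have hfr : ∀ {n m : ℕ}, n ≤ m → n = m ∨ IsFragment (x n) (x m) := fun h =>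
    h.eq_or_lt.imp id (hx _ _)
  obtain ⟨p, hp⟩ := hE (fun n => (x n)⁺) (fun n => posPart_nonneg _)
    (fun n m hnm => (hfr hnm).elim (fun h => by rw [h]) fun h => h.posPart_le)
    ⟨C, fun n => (norm_le_norm_of_abs_le_abs (by
      rw [abs_of_nonneg (posPart_nonneg _)]
      exact sup_le (le_abs_self _) (abs_nonneg _))).trans (hC n)⟩
  obtain ⟨q, hq⟩ := hE (fun n => (x n)⁻) (fun n => negPart_nonneg _)
    (fun n m hnm => (hfr hnm).elim (fun h => by rw [h]) fun h => h.negPart_le)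
    ⟨C, fun n => (norm_le_norm_of_abs_le_abs (by
      rw [abs_of_nonneg (negPart_nonneg _)]
      exact sup_le (neg_le_abs _) (abs_nonneg _))).trans (hC n)⟩
  have ha : Tendsto x atTop (𝓝 (p - q)) := by
    simpa only [posPart_sub_negPart] using hp.sub hq
  exact ⟨p - q, fun n m h => ⟨hx n m h, IsFragment.of_tendsto hx ha m⟩, ha⟩

end Norm

/-! ### From disjoint sequences to increasing norm bounded sequences -/

section BanachLattice

variable {E : Type*} [NormedAddCommGroup E] [NormedSpace ℝ E] [CompleteSpace E]
    [Lattice E] [IsOrderedAddMonoid E] [IsOrderedModule ℝ E] [HasSolidNorm E]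

/-- Disjointification: the conclusion of `DisjointBoundedSumsNull` holds already for sequences that
are only asymptotically disjoint. A subsequence `w` bounded away from zero and with rapidly
decreasing overlaps differs by a null sequence from the disjoint truncations
`(wₙ - 4ⁿ ∑_{i<n} wᵢ - 2⁻ⁿ x)⁺ ≤ wₙ`, where `x = ∑ 2⁻ⁿ wₙ`. -/
theorem DisjointBoundedSumsNull.tendsto_zero_of_asymptotically_disjoint
    (hE : DisjointBoundedSumsNull E) {u : ℕ → E} (hu : ∀ n, 0 ≤ u n)
    (hb : ∃ C : ℝ, ∀ n, ‖∑ i ∈ Finset.range n, u i‖ ≤ C)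
    (hd : ∀ i, Tendsto (fun n => u n ⊓ u i) atTop (𝓝 0)) : Tendsto u atTop (𝓝 0) := by
  obtain ⟨C, hC⟩ := hb
  by_contra hnot
  obtain ⟨δ, hδ, hfreq⟩ : ∃ δ > 0, ∃ᶠ n in atTop, δ ≤ ‖u n‖ := by
    rw [tendsto_zero_iff_norm_tendsto_zero, Metric.tendsto_nhds] at hnot
    push Not at hnot
    obtain ⟨δ, hδ, h⟩ := hnot
    exact ⟨δ, hδ, h.mono fun n hn => by simpa using hn⟩
  -- The rate `16⁻ᵏ` absorbs both the factor `4ᵏ⁺¹` of the truncation and the number `k + 1` of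
  -- earlier terms.
  have hstep : ∀ k : ℕ, ∃ m, k < m ∧ δ ≤ ‖u m‖ ∧
      ∀ i ≤ k, ‖u m ⊓ u i‖ ≤ (1 / 16 : ℝ) ^ k := by
    intro k
    have h1 : ∀ᶠ m in atTop, ∀ i ∈ Finset.range (k + 1), ‖u m ⊓ u i‖ < (1 / 16 : ℝ) ^ k :=
      (Finset.eventually_all _).2 fun i _ =>
        (tendsto_zero_iff_norm_tendsto_zero.1 (hd i)).eventually_lt_const (by positivity)
    obtain ⟨m, hm, h2, h3⟩ := (hfreq.and_eventually (h1.and (eventually_gt_atTop k))).exists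
    exact ⟨m, h3, hm, fun i hi => (h2 i (Finset.mem_range.2 (Nat.lt_succ_of_le hi))).le⟩
  choose f hf hfδ hfd using hstep
  set φ : ℕ → ℕ := fun n => f^[n + 1] 0 with hφdef
  have hφs : ∀ n, φ (n + 1) = f (φ n) := fun n => Function.iterate_succ_apply' f (n + 1) 0
  have hφ : StrictMono φ := strictMono_nat_of_lt_succ fun n => by rw [hφs]; exact hf _
  have hφδ : ∀ n, δ ≤ ‖u (φ n)‖ := fun n => by
    rw [hφdef]; simp only [Function.iterate_succ_apply']; exact hfδ _
  have hφd : ∀ n, ∀ i ≤ n, ‖u (φ (n + 1)) ⊓ u (φ i)‖ ≤ (1 / 16 : ℝ) ^ n := fun n i hi => by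
    rw [hφs]
    exact (hfd _ _ (hφ.monotone hi)).trans
      (pow_le_pow_of_le_one (by norm_num) (by norm_num) (hφ.id_le n))
  set w : ℕ → E := fun n => u (φ n) with hw
  have hw0 : ∀ n, 0 ≤ w n := fun n => hu _
  have hwsum : ∀ n, ‖∑ i ∈ Finset.range n, w i‖ ≤ C := fun n =>
    (norm_le_norm_of_nonneg_of_le (Finset.sum_nonneg fun i _ => hw0 i)
      (sum_comp_le_sum hu hφ n)).trans (hC _)
  have hwC : ∀ n, ‖w n‖ ≤ C := fun n =>
    (norm_le_norm_of_nonneg_of_le (hw0 n) (Finset.single_le_sum (f := w) (fun i _ => hw0 i)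
      (Finset.self_mem_range_succ n))).trans (hwsum (n + 1))
  have hsumm : Summable fun n => (1 / 2 : ℝ) ^ n • w n := by
    refine Summable.of_norm_bounded (g := fun n => (1 / 2 : ℝ) ^ n * C)
      (summable_geometric_two.mul_right C) fun n => ?_
    rw [norm_smul, norm_pow, Real.norm_of_nonneg (by norm_num : (0 : ℝ) ≤ 1 / 2)]
    exact mul_le_mul_of_nonneg_left (hwC n) (by positivity)
  set x : E := ∑' n, (1 / 2 : ℝ) ^ n • w n with hxdef
  have hx : ∀ n, (1 / 2 : ℝ) ^ n • w n ≤ x := fun n =>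
    hsumm.le_tsum n fun i _ => smul_nonneg (by positivity) (hw0 i)
  have hx0 : 0 ≤ x := (smul_nonneg (by positivity) (hw0 0)).trans (hx 0)
  set S : ℕ → E := fun n => (4 ^ n : ℕ) • ∑ i ∈ Finset.range n, w i with hSdef
  have hS0 : ∀ n, 0 ≤ S n := fun n => nsmul_nonneg (Finset.sum_nonneg fun i _ => hw0 i) _
  set v : ℕ → E := fun n => (w n - S n - (1 / 2 : ℝ) ^ n • x)⁺ with hvdef
  have hxn : ∀ n : ℕ, 0 ≤ (1 / 2 : ℝ) ^ n • x := fun n => smul_nonneg (by positivity) hx0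
  have hvw : ∀ n, v n ≤ w n := fun n =>
    sup_le ((sub_le_self _ (hxn n)).trans (sub_le_self _ (hS0 n))) (hw0 n)
  have hv : Tendsto v atTop (𝓝 0) := by
    refine hE v (fun n => posPart_nonneg _)
      (fun i j hij => inf_posPart_truncation_eq_zero hw0 hx hij) ⟨C, fun n => ?_⟩
    exact (norm_le_norm_of_nonneg_of_le (Finset.sum_nonneg fun i _ => posPart_nonneg _)
      (Finset.sum_le_sum fun i _ => hvw i)).trans (hwsum n)
  have hinf : ∀ n, ‖w (n + 1) ⊓ S (n + 1)‖ ≤ 4 * (1 / 2 : ℝ) ^ n * 2 := fun n => by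
    have h1 : w (n + 1) ⊓ S (n + 1) ≤
        (4 ^ (n + 1) : ℕ) • ∑ i ∈ Finset.range (n + 1), w (n + 1) ⊓ w i :=
      (inf_nsmul_le_nsmul_inf (hw0 _) (Finset.sum_nonneg fun i _ => hw0 i) _).trans
        (nsmul_le_nsmul_right (inf_sum_le_sum_inf _ (hw0 _) hw0) _)
    have h2 : ‖∑ i ∈ Finset.range (n + 1), w (n + 1) ⊓ w i‖ ≤
        (n + 1 : ℕ) * (1 / 16 : ℝ) ^ n := by
      simpa using norm_sum_le_of_le (Finset.range (n + 1)) (f := fun i => w (n + 1) ⊓ w i)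
        fun i hi => hφd n i (Nat.lt_succ_iff.1 (Finset.mem_range.1 hi))
    have h3 : ((n + 1 : ℕ) : ℝ) ≤ 2 ^ (n + 1) := by exact_mod_cast Nat.lt_two_pow_self.le
    calc ‖w (n + 1) ⊓ S (n + 1)‖
        ≤ ‖(4 ^ (n + 1) : ℕ) • ∑ i ∈ Finset.range (n + 1), w (n + 1) ⊓ w i‖ :=
          norm_le_norm_of_nonneg_of_le (le_inf (hw0 _) (hS0 _)) h1
      _ ≤ (4 ^ (n + 1) : ℕ) * ‖∑ i ∈ Finset.range (n + 1), w (n + 1) ⊓ w i‖ := norm_nsmul_le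
      _ ≤ (4 ^ (n + 1) : ℕ) * (2 ^ (n + 1) * (1 / 16 : ℝ) ^ n) := by
          gcongr
          exact h2.trans (by gcongr)
      _ = 4 * (4 * 2 * (1 / 16 : ℝ)) ^ n * 2 := by
          rw [mul_pow, mul_pow]; push_cast; ring
      _ = 4 * (1 / 2 : ℝ) ^ n * 2 := by norm_num
  have hbound : ∀ n, w n ≤ v n + w n ⊓ S n + (1 / 2 : ℝ) ^ n • x := fun n => by
    have h1 : w n - S n ≤ v n + (1 / 2 : ℝ) ^ n • x := by
      rw [← sub_le_iff_le_add]; exact le_posPart _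
    have h2 : (w n - S n) ⊔ 0 ≤ v n + (1 / 2 : ℝ) ^ n • x :=
      sup_le h1 (add_nonneg (posPart_nonneg _) (hxn n))
    have h3 : w n = (w n - S n) ⊔ 0 + w n ⊓ S n := by
      have := inf_add_sup (w n - S n) 0
      have h4 : w n ⊓ S n = (w n - S n) ⊓ 0 + S n := by rw [inf_add]; simp
      rw [h4, ← add_assoc, add_comm ((w n - S n) ⊔ 0), this]; simp
    calc w n = (w n - S n) ⊔ 0 + w n ⊓ S n := h3
      _ ≤ v n + (1 / 2 : ℝ) ^ n • x + w n ⊓ S n := by gcongr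
      _ = _ := by abel
  have hhalf : Tendsto (fun n : ℕ => (1 / 2 : ℝ) ^ n) atTop (𝓝 0) :=
    tendsto_pow_atTop_nhds_zero_of_lt_one (by norm_num) (by norm_num)
  have hinf0 : Tendsto (fun n => w n ⊓ S n) atTop (𝓝 0) := by
    refine (tendsto_add_atTop_iff_nat 1).1 (squeeze_zero_norm hinf ?_)
    simpa using (hhalf.const_mul 4).mul_const 2
  have hw_lim : Tendsto w atTop (𝓝 0) := by
    refine tendsto_zero_of_nonneg_of_le hw0 hbound ?_
    simpa using (hv.add hinf0).add (hhalf.smul_const x)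
  obtain ⟨n, hn⟩ :=
    ((tendsto_zero_iff_norm_tendsto_zero.1 hw_lim).eventually_lt_const hδ).exists
  exact absurd (hφδ n) hn.not_ge

/-- The case of bounded overlap: at most `N` of the elements are simultaneously nonzero, in the
sense that any `N + 1` of them have no nonzero positive lower bound. For fixed `i`, the sequence
`uₙ ⊓ uᵢ` with `n > i` has overlap at most `N - 1`, so that `u` is asymptotically disjoint by
induction on `N`. -/
theorem DisjointBoundedSumsNull.tendsto_zero_of_bounded_overlap
    (hE : DisjointBoundedSumsNull E) (N : ℕ) {u : ℕ → E} (hu : ∀ n, 0 ≤ u n)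
    (hb : ∃ C : ℝ, ∀ n, ‖∑ i ∈ Finset.range n, u i‖ ≤ C)
    (ho : ∀ s : Finset ℕ, s.card = N + 1 → ∀ w, (∀ i ∈ s, w ≤ u i) → w ≤ 0) :
    Tendsto u atTop (𝓝 0) := by
  induction N generalizing u with
  | zero =>
    have : u = fun _ => 0 := funext fun n =>
      le_antisymm (ho {n} rfl (u n) (by simp)) (hu n)
    rw [this]
    exact tendsto_const_nhds
  | succ N ih =>
    refine hE.tendsto_zero_of_asymptotically_disjoint hu hb fun i => ?_
    have hshift : StrictMono fun n : ℕ => n + (i + 1) := strictMono_id.add_const _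
    refine (tendsto_add_atTop_iff_nat (i + 1)).1 (ih (fun n => le_inf (hu _) (hu _)) ?_ ?_)
    · obtain ⟨C, hC⟩ := hb
      refine ⟨C, fun n => le_trans ?_ (hC (n + (i + 1)))⟩
      exact norm_le_norm_of_nonneg_of_le (Finset.sum_nonneg fun j _ => le_inf (hu _) (hu _))
        ((Finset.sum_le_sum fun j _ => inf_le_left).trans (sum_comp_le_sum hu hshift n))
    · intro s hs w hw
      have hi : i ∉ s.image fun n : ℕ => n + (i + 1) := by
        simp only [Finset.mem_image, not_exists, not_and]
        intro j _
        omega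
      refine ho (insert i (s.image fun n : ℕ => n + (i + 1))) ?_ w ?_
      · rw [Finset.card_insert_of_notMem hi, Finset.card_image_of_injective _ hshift.injective, hs]
      · intro j hj
        rcases Finset.mem_insert.1 hj with rfl | hj
        · obtain ⟨k, hk⟩ : s.Nonempty := Finset.card_pos.1 (by omega)
          exact (hw k hk).trans inf_le_right
        · obtain ⟨k, hk, rfl⟩ := Finset.mem_image.1 hj
          exact (hw k hk).trans inf_le_left

/-- The case of order bounded partial sums. Up to an error of norm `‖x‖ / (k + 1)`, the element
`uₙ` may be replaced by `(uₙ - x / (k + 1))⁺`; these have overlap at most `k` because any `k + 1`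
of the `uₙ` have sum at most `x`. -/
theorem DisjointBoundedSumsNull.tendsto_zero_of_sum_le
    (hE : DisjointBoundedSumsNull E) {u : ℕ → E} (hu : ∀ n, 0 ≤ u n) {x : E}
    (hx : ∀ n, ∑ i ∈ Finset.range n, u i ≤ x) : Tendsto u atTop (𝓝 0) := by
  have hx0 : 0 ≤ x := by simpa using hx 0
  rw [tendsto_zero_iff_norm_tendsto_zero, Metric.tendsto_nhds]
  intro ε hε
  obtain ⟨k, hk⟩ := exists_nat_gt (‖x‖ / (ε / 2))
  set t : ℝ := 1 / ((k : ℝ) + 1) with ht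
  have ht0 : 0 < t := by positivity
  have htx : ‖t • x‖ < ε / 2 := by
    rw [norm_smul, Real.norm_of_nonneg ht0.le, ht, one_div, inv_mul_lt_iff₀ (by positivity)]
    rw [div_lt_iff₀ (by positivity)] at hk
    nlinarith
  have htx0 : 0 ≤ t • x := smul_nonneg ht0.le hx0
  have hle : ∀ n, (u n - t • x)⁺ ≤ u n := fun n => sup_le (sub_le_self _ htx0) (hu n)
  have hlim : Tendsto (fun n => (u n - t • x)⁺) atTop (𝓝 0) := by
    refine hE.tendsto_zero_of_bounded_overlap k (fun n => posPart_nonneg _) ⟨‖x‖, fun n => ?_⟩ ?_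
    · exact norm_le_norm_of_nonneg_of_le (Finset.sum_nonneg fun i _ => posPart_nonneg _)
        ((Finset.sum_le_sum fun i _ => hle i).trans (hx n))
    · intro s hs w hw
      refine le_zero_of_forall_le_posPart (Finset.card_pos.1 (by omega)) ?_ hw
      have h1 : ∑ i ∈ s, u i ≤ x := by
        obtain ⟨n, hn⟩ := s.exists_nat_subset_range
        exact (Finset.sum_le_sum_of_subset_of_nonneg hn fun i _ _ => hu i).trans (hx n)
      have h2 : (k + 1) • t • x = x := by
        rw [← Nat.cast_smul_eq_nsmul ℝ, smul_smul, ht]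
        push_cast
        rw [mul_one_div_cancel (by positivity), one_smul]
      rw [Finset.sum_sub_distrib, Finset.sum_const, hs, h2]
      exact sub_nonpos.2 h1
  filter_upwards [(tendsto_zero_iff_norm_tendsto_zero.1 hlim).eventually_lt_const (half_pos hε)]
    with n hn
  rw [dist_zero_right, norm_norm]
  calc ‖u n‖ ≤ ‖(u n - t • x)⁺ + t • x‖ :=
        norm_le_norm_of_nonneg_of_le (hu n) (sub_le_iff_le_add.1 (le_posPart _))
    _ ≤ ‖(u n - t • x)⁺‖ + ‖t • x‖ := norm_add_le _ _
    _ < ε := by linarith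

theorem DisjointBoundedSumsNull.exists_tendsto_of_monotone_of_le
    (hE : DisjointBoundedSumsNull E) {x : ℕ → E} (hx : Monotone x) {b : E} (hb : ∀ n, x n ≤ b) :
    ∃ a, Tendsto x atTop (𝓝 a) := by
  refine cauchySeq_tendsto_of_complete (cauchySeq_of_forall_strictMono fun φ hφ => ?_)
  refine hE.tendsto_zero_of_sum_le (x := b - x (φ 0))
    (fun n => sub_nonneg.2 (hx (hφ n.lt_succ_self).le)) fun n => ?_
  rw [Finset.sum_range_sub (fun n => x (φ n))]
  exact sub_le_sub_right (hb _) _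

/-- Let `zₘ` be the limit in `n` of the truncated tails `(∑_{m≤i<n} uᵢ) ⊓ y`, which exists by
order continuity of the norm. Then `uₘ ⊓ y ≤ zₘ`, and `zₘ` decreases to some `z ≥ 0`. Up to small
errors `z` lies below infinitely many non-overlapping blocks of the series `∑ uᵢ`, so that the bound on
its partial sums forces `z = 0`. -/
theorem DisjointBoundedSumsNull.tendsto_inf_zero
    (hE : DisjointBoundedSumsNull E) {u : ℕ → E} (hu : ∀ n, 0 ≤ u n)
    (hb : ∃ C : ℝ, ∀ n, ‖∑ i ∈ Finset.range n, u i‖ ≤ C) {y : E} (hy : 0 ≤ y) :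
    Tendsto (fun n => u n ⊓ y) atTop (𝓝 0) := by
  obtain ⟨C, hC⟩ := hb
  set T : ℕ → E := fun n => ∑ i ∈ Finset.range n, u i with hT
  have hTm : Monotone T := monotone_nat_of_le_succ fun n => by
    rw [hT]; simp only [Finset.sum_range_succ]; exact le_add_of_nonneg_right (hu n)
  have htail : ∀ m, ∃ z, Tendsto (fun n => (T n - T m) ⊓ y) atTop (𝓝 z) := fun m =>
    hE.exists_tendsto_of_monotone_of_le
      (fun a b hab => inf_le_inf_right _ (sub_le_sub_right (hTm hab) _)) fun n => inf_le_right
  choose z hz using htail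
  have hz_nonneg : ∀ m, 0 ≤ z m := fun m => by
    refine ge_of_tendsto (hz m) ?_
    filter_upwards [eventually_ge_atTop m] with n hn
    exact le_inf (sub_nonneg.2 (hTm hn)) hy
  have hz_anti : Antitone z := fun m m' h =>
    le_of_tendsto_of_tendsto' (hz m') (hz m) fun n =>
      inf_le_inf_right _ (sub_le_sub_left (hTm h) _)
  have huz : ∀ m, u m ⊓ y ≤ z m := fun m => by
    refine ge_of_tendsto (hz m) ?_
    filter_upwards [eventually_ge_atTop (m + 1)] with n hn
    refine inf_le_inf_right _ (le_sub_iff_add_le'.2 ?_)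
    calc T m + u m = T (m + 1) := (Finset.sum_range_succ u m).symm
      _ ≤ T n := hTm hn
  obtain ⟨c, hc⟩ := hE.exists_tendsto_of_monotone_of_le (x := fun m => -z m) (b := 0)
    (fun m m' h => neg_le_neg (hz_anti h)) (fun m => neg_nonpos.2 (hz_nonneg m))
  have hzlim : Tendsto z atTop (𝓝 (-c)) := by simpa using hc.neg
  set a : E := -c with ha
  have ha0 : 0 ≤ a := ge_of_tendsto' hzlim hz_nonneg
  have haz : ∀ m, a ≤ z m := fun m => hz_anti.le_of_tendsto hzlim m
  -- `j` consecutive blocks of the series dominate `j • a`, with an error at most `η` per block.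
  have hblocks : ∀ η > 0, ∀ j : ℕ, ∃ m, ∃ e : E, j • a ≤ T m + e ∧ ‖e‖ ≤ j * η := by
    intro η hη j
    induction j with
    | zero => exact ⟨0, 0, by simp [hT], by simp⟩
    | succ j ih =>
      obtain ⟨m, e, h1, h2⟩ := ih
      obtain ⟨n, hn⟩ := ((Metric.tendsto_nhds.1 (hz m)) η hη).exists
      rw [dist_comm, dist_eq_norm] at hn
      refine ⟨n, e + (z m - (T n - T m) ⊓ y), ?_, ?_⟩
      · calc (j + 1) • a = j • a + a := succ_nsmul a j
          _ ≤ (T m + e) + ((T n - T m) + (z m - (T n - T m) ⊓ y)) := by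
            refine add_le_add h1 ((haz m).trans ?_)
            calc z m = (T n - T m) ⊓ y + (z m - (T n - T m) ⊓ y) := by abel
              _ ≤ _ := by gcongr; exact inf_le_left
          _ = T n + (e + (z m - (T n - T m) ⊓ y)) := by abel
      · push_cast
        rw [add_mul, one_mul]
        exact (norm_add_le _ _).trans (add_le_add h2 hn.le)
  have ha_zero : a = 0 := by
    by_contra hne
    have hpos : 0 < ‖a‖ := norm_pos_iff.2 hne
    obtain ⟨j, hj⟩ := exists_nat_gt (C / (‖a‖ / 2))
    obtain ⟨m, e, h1, h2⟩ := hblocks (‖a‖ / 2) (half_pos hpos) j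
    have h3 : (j : ℝ) * ‖a‖ ≤ C + j * (‖a‖ / 2) := by
      calc (j : ℝ) * ‖a‖ = ‖j • a‖ := by
            rw [← Nat.cast_smul_eq_nsmul ℝ, norm_smul, Real.norm_natCast]
        _ ≤ ‖T m + e‖ := norm_le_norm_of_nonneg_of_le (nsmul_nonneg ha0 j) h1
        _ ≤ ‖T m‖ + ‖e‖ := norm_add_le _ _
        _ ≤ C + j * (‖a‖ / 2) := add_le_add (hC m) h2
    rw [div_lt_iff₀ (half_pos hpos)] at hj
    linarith
  rw [ha_zero] at hzlim
  exact tendsto_zero_of_nonneg_of_le (fun n => le_inf (hu n) hy) huz hzlim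

theorem DisjointBoundedSumsNull.isKBSpace (hE : DisjointBoundedSumsNull E) : IsKBSpace E := by
  rintro x hx0 hx ⟨C, hC⟩
  refine cauchySeq_tendsto_of_complete (cauchySeq_of_forall_strictMono fun φ hφ => ?_)
  have hu : ∀ n, 0 ≤ x (φ (n + 1)) - x (φ n) := fun n =>
    sub_nonneg.2 (hx (hφ n.lt_succ_self).le)
  have hb : ∃ C : ℝ, ∀ n, ‖∑ i ∈ Finset.range n, (x (φ (i + 1)) - x (φ i))‖ ≤ C := by
    refine ⟨C, fun n => (norm_le_norm_of_nonneg_of_le (Finset.sum_nonneg fun i _ => hu i) ?_).trans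
      (hC (φ n))⟩
    rw [Finset.sum_range_sub (fun n => x (φ n))]
    exact sub_le_self _ (hx0 _)
  exact hE.tendsto_zero_of_asymptotically_disjoint hu hb fun i => hE.tendsto_inf_zero hu hb (hu i)

end BanachLattice

end LateralConvergence

theorem theorem2p9 {E : Type*} [NormedAddCommGroup E] [NormedSpace ℝ E] [CompleteSpace E]
    [Lattice E] [IsOrderedAddMonoid E] [IsOrderedModule ℝ E] [HasSolidNorm E] :
    LateralConvergence.IsKBSpace E ↔
      ∀ x : ℕ → E, (∃ C : ℝ, ∀ n, ‖x n‖ ≤ C) → LateralConvergence.IsLaterallyCauchy x →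
        ∃ a : E, LateralConvergence.LaterallyNormConvergesTo x a :=
  ⟨fun hE _ hb hx => hE.exists_laterallyNormConvergesTo hb hx, fun h =>
    (LateralConvergence.disjointBoundedSumsNull_of_lateral h).isKBSpace⟩
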